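/- Let $(X,d)$ be a finite metric space and let $w_1,w_2:X\to[0,\infty)$ be two nonnegative weight functions. Then for every $\varepsilon\in(0,1)$ there exists a subset $S\subseteq X$ such that $(S,d)$ embeds into an ultrametric space with distortion $$D=\frac{2}{\varepsilon(1-\varepsilon)^{\frac{1-\varepsilon}{\varepsilon}}},$$ and $$\Bigl(\sum_{x\in S}w_1(x)\Bigr)\Bigl(\sum_{x\in X}w_2(x)\Bigr)^{\varepsilon}\ \ge\ \sum_{x\in X}w_1(x)\,w_2(x)^{\varepsilon}.$$ Here an ultrametric space is a metric space $(U,\rho)$ with $\rho(x,y)\le\max\{\rho(x,z),\rho(z,y)\}$ for all $x,y,z\in U$, and $(S,d)$ embeds with distortion $D$ into $(U,\rho)$ if there exist $f:S\to U$ and $\lambda>0$ such that $\lambda d(x,y)\le\rho(f(x),f(y))\le D\lambda d(x,y)$ for all $x,y\in S$. -/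

import Mathlib

universe u v

/-- The metric space `X` embeds with distortion `D` into the metric space `Y`: there are a map
`f : X → Y` and a scaling factor `c > 0` such that
`c * d(x, y) ≤ d(f x, f y) ≤ D * c * d(x, y)` for all `x, y`. -/
def EmbedsWithDistortion (D : ℝ) (X : Type u) (Y : Type v) [MetricSpace X] [MetricSpace Y] :
    Prop :=
  ∃ f : X → Y, ∃ c : ℝ, 0 < c ∧ ∀ x y : X,
    c * dist x y ≤ dist (f x) (f y) ∧ dist (f x) (f y) ≤ D * c * dist x y

/-- The metric space `X` embeds with distortion `D` into some ultrametric space, i.e. a metric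
space with `d(x, z) ≤ max (d(x, y)) (d(y, z))`. -/
def EmbedsIntoUltrametric (D : ℝ) (X : Type u) [MetricSpace X] : Prop :=
  ∃ (U : Type u) (_ : MetricSpace U), IsUltrametricDist U ∧ EmbedsWithDistortion D X U

/-! A random centre drawn with weight `w₂`, keeping the ball of radius `s * R` and discarding the
rest of the `R`-ball, retains `x` with probability the ratio of its two ball weights. Averaging
makes this deterministic (`exists_fragmentation`), and over scales the ratios multiply. For scales
in geometric progression of ratio `exp L` and `s = exp (-(ε * L))`, the logarithm of the product,
averaged over a shift of the scales, telescopes to `ε * log (w₂ x / W)`, with `W` the total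
`w₂`-weight. Convexity of `exp` then gives one good shift (`exists_shift`). Clusters of radius `s *
r i`, separated by `(1 - s) * r i`, give an ultrametric on the survivors
(`EmbedsIntoUltrametric.of_clusters`). -/

/-- The total weight of the closed ball of radius `r` about `x`. -/
noncomputable def ballWeight {X : Type u} [MetricSpace X] [Fintype X] (w : X → ℝ) (x : X) (r : ℝ) :
    ℝ :=
  ∑ y with dist x y ≤ r, w y

/-! ### Ball weights and fragmentation -/

section BallWeight

variable {X : Type u} [MetricSpace X] [Fintype X] {w : X → ℝ}

theorem ballWeight_nonneg (hw : ∀ x, 0 ≤ w x) (x : X) (r : ℝ) : 0 ≤ ballWeight w x r :=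
  Finset.sum_nonneg fun y _ => hw y

theorem ballWeight_mono (hw : ∀ x, 0 ≤ w x) (x : X) : Monotone (ballWeight w x) := by
  intro r r' h
  refine Finset.sum_le_sum_of_subset_of_nonneg ?_ fun y _ _ => hw y
  intro y hy
  simp only [Finset.mem_filter, Finset.mem_univ, true_and] at hy ⊢
  exact hy.trans h

theorem ballWeight_pos (hw : ∀ x, 0 ≤ w x) {x : X} (hx : 0 < w x) {r : ℝ} (hr : 0 ≤ r) :
    0 < ballWeight w x r :=
  hx.trans_le (Finset.single_le_sum (f := w) (fun y _ => hw y) (by simpa using hr))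

theorem ballWeight_eq_sum {x : X} {r : ℝ} (h : ∀ y, dist x y ≤ r) :
    ballWeight w x r = ∑ y, w y := by
  simp [ballWeight, h]

theorem ballWeight_eq_self {x : X} {r : ℝ} (hr : 0 ≤ r) (h : ∀ y, x ≠ y → r < dist x y) :
    ballWeight w x r = w x := by
  classical
  have : (Finset.univ.filter fun y => dist x y ≤ r) = {x} := by
    ext y
    simp only [Finset.mem_filter, Finset.mem_univ, true_and, Finset.mem_singleton]
    constructor
    · intro hy
      by_contra hne
      exact absurd hy (not_le.2 (h y (Ne.symm hne)))
    · rintro rfl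
      simpa using hr
  rw [ballWeight, this, Finset.sum_singleton]

theorem sum_mul_ballWeight (w u : X → ℝ) (A : Finset X) (r : ℝ) :
    ∑ x ∈ A, u x * ballWeight w x r = ∑ c, w c * ∑ x ∈ A with dist x c ≤ r, u x := by
  simp only [ballWeight, Finset.sum_filter, Finset.mul_sum, mul_ite, mul_zero]
  rw [Finset.sum_comm]
  simp only [mul_comm]

/-- Fragmentation of a finite metric space at a single scale `R`: the retained points are
clustered around centres at distance at most `r`, and different clusters are `R - r` apart. -/
theorem exists_fragmentation (hw : ∀ x, 0 ≤ w x) (u : X → ℝ) {r R : ℝ}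
    (hrR : r < R) (A : Finset X) :
    ∃ T ⊆ A, ∃ c : X → X, (∀ x ∈ T, dist x (c x) ≤ r) ∧
      (∀ x ∈ T, ∀ y ∈ T, c x ≠ c y → R - r ≤ dist x y) ∧
      ∑ x ∈ A, u x * (ballWeight w x r / ballWeight w x R) ≤ ∑ x ∈ T, u x := by
  classical
  induction A using Finset.strongInduction with
  | H A ih =>
  set p : X → ℝ := fun x => ballWeight w x r / ballWeight w x R with hp
  have hp_mul : ∀ x, p x * ballWeight w x R = ballWeight w x r := by
    intro x
    rcases eq_or_ne (ballWeight w x R) 0 with h | h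
    · have h1 := ballWeight_mono hw x hrR.le
      have h2 := ballWeight_nonneg hw x r
      rw [h, mul_zero]
      linarith
    · exact div_mul_cancel₀ _ h
  -- Double counting: averaged over centres, the discounted mass of the large balls equals the full
  -- mass of the small ones.
  have key : ∑ c, w c * ∑ x ∈ A with dist x c ≤ R, u x * p x =
      ∑ c, w c * ∑ x ∈ A with dist x c ≤ r, u x := by
    rw [← sum_mul_ballWeight, ← sum_mul_ballWeight]
    exact Finset.sum_congr rfl fun x _ => by rw [mul_assoc, hp_mul]
  -- Positive weight allows cancelling `w c`; meeting `A` makes the recursion outside the `R`-ball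
  -- strict.
  let C : Finset X := {c | 0 < w c ∧ (A.filter fun x => dist x c ≤ R).Nonempty}
  have hC : ∀ c ∉ C, w c = 0 ∨ ∀ x ∈ A, R < dist x c := by
    intro c hc
    simp only [C, Finset.mem_filter, Finset.mem_univ, true_and, not_and,
      Finset.not_nonempty_iff_eq_empty, Finset.filter_eq_empty_iff, not_le] at hc
    rcases (hw c).eq_or_lt with h | h
    · exact Or.inl h.symm
    · exact Or.inr fun x hx => hc h hx
  rcases C.eq_empty_or_nonempty with hCe | hCn
  · refine ⟨∅, Finset.empty_subset _, id, by simp, by simp, ?_⟩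
    rw [Finset.sum_empty]
    refine Finset.sum_nonpos fun x hx => ?_
    have : ballWeight w x R = 0 := by
      refine Finset.sum_eq_zero fun y hy => ?_
      rcases hC y (by simp [hCe]) with h | h
      · exact h
      · exact absurd (Finset.mem_filter.1 hy).2 (not_le.2 (h x hx))
    simp [this]
  · have hsum : ∀ (ρ : ℝ) (f : X → ℝ), ρ ≤ R →
        ∑ c, w c * ∑ x ∈ A with dist x c ≤ ρ, f x =
          ∑ c ∈ C, w c * ∑ x ∈ A with dist x c ≤ ρ, f x := by
      intro ρ f hρ
      refine (Finset.sum_subset (Finset.subset_univ C) fun c _ hc => ?_).symm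
      rcases hC c hc with h | h
      · rw [h, zero_mul]
      · rw [Finset.filter_false_of_mem, Finset.sum_empty, mul_zero]
        exact fun x hx => not_le.2 (hρ.trans_lt (h x hx))
    rw [hsum R _ le_rfl, hsum r _ hrR.le] at key
    obtain ⟨c₀, hc₀, hle⟩ := Finset.exists_le_of_sum_le hCn key.le
    obtain ⟨hwc, hne⟩ := (Finset.mem_filter.1 hc₀).2
    replace hle := le_of_mul_le_mul_left hle hwc
    have hss : (A.filter fun x => ¬ dist x c₀ ≤ R) ⊂ A := by
      rw [Finset.filter_ssubset]
      obtain ⟨x, hx⟩ := hne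
      rw [Finset.mem_filter] at hx
      exact ⟨x, hx.1, not_not.2 hx.2⟩
    obtain ⟨T, hTA, c, hc, hsep, hT⟩ := ih _ hss
    have hfar : ∀ x ∈ T, R < dist x c₀ := fun x hx =>
      not_le.1 (Finset.mem_filter.1 (hTA hx)).2
    have hdisj : Disjoint (A.filter fun x => dist x c₀ ≤ r) T := by
      rw [Finset.disjoint_left]
      intro x hx hxT
      have h1 := (Finset.mem_filter.1 hx).2
      have h2 := hfar x hxT
      linarith
    have hsep' : ∀ x, dist x c₀ ≤ r → ∀ y ∈ T, R - r ≤ dist x y := by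
      intro x hx y hy
      have h1 := hfar y hy
      have h2 := dist_triangle_left y c₀ x
      linarith
    refine ⟨(A.filter fun x => dist x c₀ ≤ r) ∪ T,
      Finset.union_subset (Finset.filter_subset _ _) (hTA.trans (Finset.filter_subset _ _)),
      fun x => if dist x c₀ ≤ r then c₀ else c x, ?_, ?_, ?_⟩
    · intro x hx
      by_cases h : dist x c₀ ≤ r
      · simp [h]
      · simp only [h, if_false]
        rcases Finset.mem_union.1 hx with h' | h'
        · exact absurd (Finset.mem_filter.1 h').2 h
        · exact hc x h'
    · intro x hx y hy hxy
      have mem : ∀ z ∈ (A.filter fun x => dist x c₀ ≤ r) ∪ T, ¬ dist z c₀ ≤ r → z ∈ T := by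
        intro z hz hz'
        rcases Finset.mem_union.1 hz with h' | h'
        · exact absurd (Finset.mem_filter.1 h').2 hz'
        · exact h'
      by_cases h : dist x c₀ ≤ r <;> by_cases h' : dist y c₀ ≤ r
      · simp [h, h'] at hxy
      · exact hsep' x h y (mem y hy h')
      · rw [dist_comm]
        exact hsep' y h' x (mem x hx h)
      · simp only [h, h', if_false] at hxy
        exact hsep x (mem x hx h) y (mem y hy h') hxy
    · rw [Finset.sum_union hdisj, ← Finset.sum_filter_add_sum_filter_not A (fun x => dist x c₀ ≤ R)]
      exact add_le_add hle hT

/-- Fragmentation of a finite metric space at finitely many scales simultaneously. -/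
theorem exists_fragmentation_scales (hw : ∀ x, 0 ≤ w x) {s : ℝ} (hs : s < 1) {r : ℕ → ℝ}
    (hr : ∀ i, 0 < r i) (n : ℕ) {u : X → ℝ} (hu : ∀ x, 0 ≤ u x) :
    ∃ (S : Finset X) (c : ℕ → X → X), (∀ i < n, ∀ x ∈ S, dist x (c i x) ≤ s * r i) ∧
      (∀ i < n, ∀ x ∈ S, ∀ y ∈ S, c i x ≠ c i y → (1 - s) * r i ≤ dist x y) ∧
      ∑ x, u x * ∏ i ∈ Finset.range n, (ballWeight w x (s * r i) / ballWeight w x (r i)) ≤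
        ∑ x ∈ S, u x := by
  induction n generalizing u with
  | zero => exact ⟨Finset.univ, fun _ => id, by simp, by simp, by simp⟩
  | succ n ih =>
    set p : X → ℝ := fun x => ballWeight w x (s * r n) / ballWeight w x (r n) with hp
    -- The factor of the last scale is absorbed into `u`. Ball weights always refer to all of `X`,
    -- so they do not change as points are discarded.
    obtain ⟨S, c, h1, h2, h3⟩ := ih (u := fun x => u x * p x) fun x =>
      mul_nonneg (hu x) (div_nonneg (ballWeight_nonneg hw _ _) (ballWeight_nonneg hw _ _))
    have hlt : s * r n < r n := by nlinarith [hr n]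
    obtain ⟨T, hTS, c', h1', h2', h3'⟩ := exists_fragmentation hw u hlt S
    refine ⟨T, Function.update c n c', ?_, ?_, ?_⟩
    · intro i hi x hx
      rcases (Nat.lt_succ_iff_lt_or_eq.1 hi) with h | rfl
      · rw [Function.update_of_ne h.ne]
        exact h1 i h x (hTS hx)
      · rw [Function.update_self]
        exact h1' x hx
    · intro i hi x hx y hy
      rcases (Nat.lt_succ_iff_lt_or_eq.1 hi) with h | rfl
      · rw [Function.update_of_ne h.ne]
        exact h2 i h x (hTS hx) y (hTS hy)
      · rw [Function.update_self]
        intro hxy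
        have := h2' x hx y hy hxy
        linarith
    · refine le_trans (le_of_eq ?_) (h3.trans h3')
      refine Finset.sum_congr rfl fun x _ => ?_
      rw [Finset.prod_range_succ]
      ring

end BallWeight

/-! ### From clusterings to ultrametrics -/

/-- A function comparable to the metric and satisfying the axioms of an ultrametric provides an
embedding into an ultrametric space. -/
theorem EmbedsIntoUltrametric.of_comparable {Y : Type u} [MetricSpace Y] {D : ℝ} (ρ : Y → Y → ℝ)
    (hself : ∀ x, ρ x x = 0) (hcomm : ∀ x y, ρ x y = ρ y x)
    (hultra : ∀ x y z, ρ x z ≤ max (ρ x y) (ρ y z))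
    (hle : ∀ x y, dist x y ≤ ρ x y) (hge : ∀ x y, ρ x y ≤ D * dist x y) :
    EmbedsIntoUltrametric D Y := by
  have hnn : ∀ x y, 0 ≤ ρ x y := fun x y => dist_nonneg.trans (hle x y)
  let m : MetricSpace Y :=
    { dist := ρ
      dist_self := hself
      dist_comm := hcomm
      dist_triangle := fun x y z =>
        (hultra x y z).trans (max_le_add_of_nonneg (hnn x y) (hnn y z))
      eq_of_dist_eq_zero := fun {x y} h =>
        dist_le_zero.1 ((hle x y).trans (le_of_eq h)) }
  refine ⟨Y, m, @IsUltrametricDist.mk Y m.toDist hultra, id, 1, one_pos, fun x y => ⟨?_, ?_⟩⟩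
  · rw [one_mul]
    exact hle x y
  · rw [mul_one]
    exact hge x y

/-- Clusterings of a metric space at geometrically decreasing scales `r i`, with clusters of radius
`s * r i` that are `(1 - s) * r i` apart, yield an embedding into an ultrametric space. -/
theorem EmbedsIntoUltrametric.of_clusters {X : Type u} [MetricSpace X] (S : Set X) {s τ : ℝ}
    (hs₀ : 0 < s) (hs₁ : s < 1) (hτ : 1 ≤ 2 * s * τ) {r : ℕ → ℝ} (hr : ∀ i, 0 < r i)
    (hrτ : ∀ i, r i = τ * r (i + 1)) {n : ℕ} (c : ℕ → X → X)
    (hc : ∀ i < n, ∀ x ∈ S, dist x (c i x) ≤ s * r i)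
    (hsep : ∀ i < n, ∀ x ∈ S, ∀ y ∈ S, c i x ≠ c i y → (1 - s) * r i ≤ dist x y)
    (htop : ∀ x y : X, dist x y ≤ r 0) (hn : 0 < n)
    (hbot : ∀ x y : X, x ≠ y → 2 * s * r (n - 1) < dist x y) :
    EmbedsIntoUltrametric (2 * s * τ / (1 - s)) S := by
  classical
  have hτ₀ : 0 ≤ 2 * s * τ := zero_le_one.trans hτ
  have hs : 0 < 1 - s := sub_pos.2 hs₁
  -- For `i > 0` this is `2 * s * r (i - 1)`, the diameter bound one scale up. A supremum of
  -- two-valued ultrametrics is an ultrametric, so clusterings need not be nested.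
  let v : ℕ → NNReal := fun i => ⟨2 * s * τ * r i, mul_nonneg hτ₀ (hr i).le⟩
  let ρ : S → S → NNReal := fun x y =>
    (Finset.range n).sup fun i => if c i x = c i y then 0 else v i
  have hv_le : ∀ x y : S, ∀ i < n, c i x ≠ c i y → 2 * s * τ * r i ≤ (ρ x y : ℝ) := by
    intro x y i hi hne
    have : v i ≤ ρ x y := by
      have := Finset.le_sup (f := fun i => if c i x = c i y then 0 else v i)
        (Finset.mem_range.2 hi)
      simpa [hne] using this
    exact_mod_cast this
  have hsame : ∀ x y : S, ∀ i < n, c i x = c i y → dist x y ≤ 2 * s * r i := by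
    intro x y i hi heq
    have h1 := hc i hi x x.2
    have h2 := hc i hi y y.2
    rw [← heq] at h2
    have h3 := dist_triangle_right (x : X) y (c i x)
    rw [Subtype.dist_eq]
    linarith
  refine EmbedsIntoUltrametric.of_comparable (fun x y => (ρ x y : ℝ)) ?_ ?_ ?_ ?_ ?_
  · intro x
    simp [ρ]
  · intro x y
    simp only [ρ, eq_comm]
  · intro x y z
    rw [← NNReal.coe_max, NNReal.coe_le_coe]
    refine Finset.sup_le fun i hi => ?_
    by_cases hxz : c i x = c i z
    · simp [hxz]
    rw [if_neg hxz]
    have hi' := fun x y : S => Finset.le_sup (f := fun i => if c i x = c i y then 0 else v i) hi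
    by_cases hxy : c i x = c i y
    · have hyz : c i y ≠ c i z := fun h => hxz (hxy.trans h)
      exact le_max_of_le_right (by simpa [hyz] using hi' y z)
    · exact le_max_of_le_left (by simpa [hxy] using hi' x y)
  · intro x y
    rcases eq_or_ne x y with rfl | hxy
    · simp
    have hex : ∃ i, i < n ∧ c i x ≠ c i y := by
      refine ⟨n - 1, by omega, fun h => ?_⟩
      have h1 := hsame x y (n - 1) (by omega) h
      have h2 := hbot x y (fun h => hxy (Subtype.ext h))
      rw [Subtype.dist_eq] at h1
      linarith
    obtain ⟨hin, hine⟩ := Nat.find_spec hex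
    have hmin := fun j => Nat.find_min hex (m := j)
    refine le_trans ?_ (hv_le x y _ hin hine)
    -- At the first separating scale, the pair still shares a cluster one scale up, or `htop`
    -- applies.
    generalize Nat.find hex = i at *
    cases i with
    | zero =>
      have := htop x y
      rw [Subtype.dist_eq]
      nlinarith [hr 0]
    | succ j =>
      have hj := hmin j (Nat.lt_succ_self j)
      have := hsame x y j (by omega) (by by_contra h; exact hj ⟨by omega, h⟩)
      rw [hrτ j] at this
      linarith
  · intro x y
    have hD : 0 ≤ 2 * s * τ / (1 - s) * dist x y := by positivity
    rw [← NNReal.coe_mk _ hD, NNReal.coe_le_coe]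
    refine Finset.sup_le fun i hi => ?_
    split_ifs with h
    · exact zero_le
    · rw [← NNReal.coe_le_coe]
      change 2 * s * τ * r i ≤ 2 * s * τ / (1 - s) * dist x y
      have := hsep i (Finset.mem_range.1 hi) x x.2 y y.2 h
      rw [div_mul_eq_mul_div, le_div_iff₀ hs, Subtype.dist_eq]
      nlinarith

/-! ### Averaging over the shift -/

open intervalIntegral in
/-- The average over a shift `t` of a telescoping sum over shifted arithmetic progressions, for a
monotone function that is eventually constant on both sides. -/
theorem integral_sum_shift_sub {φ : ℝ → ℝ} (hφ : Monotone φ) {A B K L δ : ℝ} (hδ : 0 ≤ δ) (n : ℕ)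
    (hA : ∀ a ≤ K + L - n * L, φ a = A) (hB : ∀ a, K + L - δ ≤ a → φ a = B) :
    ∫ t in (0 : ℝ)..L, ∑ i ∈ Finset.range n, (φ (K + t - i * L - δ) - φ (K + t - i * L)) =
      δ * (A - B) := by
  have hint : ∀ a b, IntervalIntegrable φ MeasureTheory.volume a b := fun a b =>
    hφ.intervalIntegrable
  have hint' : ∀ a b, IntervalIntegrable (fun t => φ (t - δ)) MeasureTheory.volume a b :=
    fun a b => (hφ.comp fun x y h => sub_le_sub_right h δ).intervalIntegrable
  have hterm : ∀ i : ℕ, IntervalIntegrable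
      (fun t => φ (K + t - i * L - δ) - φ (K + t - i * L)) MeasureTheory.volume 0 L := by
    intro i
    refine IntervalIntegrable.sub (Monotone.intervalIntegrable ?_) (Monotone.intervalIntegrable ?_)
    · exact fun x y h => hφ (by linarith)
    · exact fun x y h => hφ (by linarith)
  rw [intervalIntegral.integral_finsetSum fun i _ => hterm i]
  have hshift : ∀ i : ℕ, ∫ t in (0 : ℝ)..L, (φ (K + t - i * L - δ) - φ (K + t - i * L)) =
      ∫ t in (K - i * L)..(K + L - i * L), (φ (t - δ) - φ t) := by
    intro i
    have := integral_comp_add_left (a := 0) (b := L) (fun t => φ (t - δ) - φ t) (K - i * L)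
    rw [add_zero, show K - i * L + L = K + L - i * L by ring] at this
    rw [← this]
    congr 1
    ext t
    rw [show K - i * L + t = K + t - i * L by ring]
  -- The translated intervals of length `L` tile one long interval.
  have htel : ∀ m : ℕ, ∑ i ∈ Finset.range m,
      ∫ t in (0 : ℝ)..L, (φ (K + t - i * L - δ) - φ (K + t - i * L)) =
      ∫ t in (K + L - m * L)..(K + L), (φ (t - δ) - φ t) := by
    intro m
    induction m with
    | zero => simp
    | succ m ih =>
      rw [Finset.sum_range_succ, ih, hshift, add_comm]
      rw [show K - m * L = K + L - (m + 1 : ℕ) * L by push_cast; ring]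
      exact integral_add_adjacent_intervals ((hint' _ _).sub (hint _ _))
        ((hint' _ _).sub (hint _ _))
  rw [htel, integral_sub (hint' _ _) (hint _ _), integral_comp_sub_right]
  set a := K + L - n * L
  set b := K + L
  -- The common part cancels, leaving two end pieces of length `δ` where `φ` is constant.
  rw [← integral_add_adjacent_intervals (hint (a - δ) a) (hint a (b - δ)),
    ← integral_add_adjacent_intervals (hint a (b - δ)) (hint (b - δ) b)]
  have h1 : ∫ t in (a - δ)..a, φ t = δ * A := by
    rw [integral_congr (g := fun _ => A), integral_const]
    · simp
    · intro t ht
      rw [Set.uIcc_of_le (by linarith)] at ht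
      exact hA t ht.2
  have h2 : ∫ t in (b - δ)..b, φ t = δ * B := by
    rw [integral_congr (g := fun _ => B), integral_const]
    · simp
    · intro t ht
      rw [Set.uIcc_of_le (by linarith)] at ht
      exact hB t ht.1
  rw [h1, h2]
  ring

theorem intervalIntegrable_finsetSum {ι : Type*} {s : Finset ι} {f : ι → ℝ → ℝ} {a b : ℝ}
    (h : ∀ i ∈ s, IntervalIntegrable (f i) MeasureTheory.volume a b) :
    IntervalIntegrable (fun t => ∑ i ∈ s, f i t) MeasureTheory.volume a b := by
  rw [← Finset.sum_fn]
  exact IntervalIntegrable.sum s h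

theorem exists_nonneg_of_integral_eq_zero {g : ℝ → ℝ} {a b : ℝ} (hab : a < b)
    (hg : IntervalIntegrable g MeasureTheory.volume a b) (h : ∫ t in a..b, g t = 0) :
    ∃ t ∈ Set.Ioo a b, 0 ≤ g t := by
  by_contra! hneg
  have := intervalIntegral.intervalIntegral_pos_of_pos_on hg.neg
    (fun t ht => neg_pos.2 (hneg t ht)) hab
  simp [h] at this

section Shift

variable {X : Type u} [MetricSpace X] [Fintype X] {w : X → ℝ}

theorem monotone_log_ballWeight_exp (hw : ∀ x, 0 ≤ w x) {x : X} (hx : 0 < w x) :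
    Monotone fun a => Real.log (ballWeight w x (Real.exp a)) := fun _ _ h =>
  Real.log_le_log (ballWeight_pos hw hx (Real.exp_pos _).le)
    (ballWeight_mono hw x (Real.exp_le_exp.2 h))

/-- For a suitable choice of the shift `t`, the scales `exp (K + t - i * L)` retain enough weight. -/
theorem exists_shift (hw : ∀ x, 0 ≤ w x) {u : X → ℝ} (hu : ∀ x, 0 ≤ u x) {ε K L : ℝ}
    (hε₀ : 0 < ε) (hε₁ : ε < 1) (hL : 0 < L) (n : ℕ)
    (htop : ∀ x y : X, dist x y ≤ Real.exp K)
    (hbot : ∀ x y : X, x ≠ y → Real.exp (K + L - n * L) < dist x y) :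
    ∃ t ∈ Set.Ioo 0 L, ∑ x, u x * (w x / ∑ y, w y) ^ ε ≤
      ∑ x, u x * ∏ i ∈ Finset.range n,
        (ballWeight w x (Real.exp (-(ε * L)) * Real.exp (K + t - i * L)) /
          ballWeight w x (Real.exp (K + t - i * L))) := by
  classical
  set φ : X → ℝ → ℝ := fun x a => Real.log (ballWeight w x (Real.exp a)) with hφ
  set G : X → ℝ → ℝ := fun x t => ∑ i ∈ Finset.range n,
    (φ x (K + t - i * L - ε * L) - φ x (K + t - i * L)) with hG
  set W := ∑ y, w y with hW
  have hWx : ∀ x, w x ≤ W := fun x =>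
    Finset.single_le_sum (f := w) (fun y _ => hw y) (Finset.mem_univ x)
  set m : X → ℝ := fun x => ε * (Real.log W - Real.log (w x)) with hm
  have hGint : ∀ x, 0 < w x → IntervalIntegrable (G x) MeasureTheory.volume 0 L := by
    intro x hx
    have hmono := monotone_log_ballWeight_exp hw hx
    refine intervalIntegrable_finsetSum fun i _ => IntervalIntegrable.sub
      (Monotone.intervalIntegrable ?_) (Monotone.intervalIntegrable ?_)
    · exact fun a b h => hmono (by linarith)
    · exact fun a b h => hmono (by linarith)
  have hGm : ∀ x, 0 < w x → ∫ t in (0 : ℝ)..L, (G x t + m x) = 0 := by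
    intro x hx
    rw [intervalIntegral.integral_add (hGint x hx) intervalIntegrable_const,
      integral_sum_shift_sub (monotone_log_ballWeight_exp hw hx)
        (A := Real.log (w x)) (B := Real.log W) (by positivity) n ?_ ?_,
      intervalIntegral.integral_const]
    · simp only [hm, smul_eq_mul]
      ring
    · intro a ha
      rw [ballWeight_eq_self (Real.exp_pos _).le]
      exact fun y hy => (Real.exp_le_exp.2 ha).trans_lt (hbot x y hy)
    · intro a ha
      rw [ballWeight_eq_sum]
      refine fun y => (htop x y).trans (Real.exp_le_exp.2 ?_)
      nlinarith
  -- Logarithms need `w x > 0`; the other points add nothing to the target, since `0 ^ ε = 0`.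
  set P : Finset X := {x | 0 < w x} with hP
  have hPw : ∀ x ∈ P, 0 < w x := fun x hx => (Finset.mem_filter.1 hx).2
  set q : X → ℝ := fun x => u x * (w x / W) ^ ε with hq
  have hGint' : ∀ x ∈ P, IntervalIntegrable (fun t => q x * (G x t + m x))
      MeasureTheory.volume 0 L := fun x hx =>
    ((hGint x (hPw x hx)).add intervalIntegrable_const).const_mul _
  obtain ⟨t, ht, hnn⟩ := exists_nonneg_of_integral_eq_zero hL
    (g := fun t => ∑ x ∈ P, q x * (G x t + m x)) (intervalIntegrable_finsetSum hGint') (by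
      rw [intervalIntegral.integral_finsetSum hGint']
      refine Finset.sum_eq_zero fun x hx => ?_
      rw [intervalIntegral.integral_const_mul, hGm x (hPw x hx), mul_zero])
  refine ⟨t, ht, ?_⟩
  have hprod : ∀ x, 0 ≤ u x * ∏ i ∈ Finset.range n,
        (ballWeight w x (Real.exp (-(ε * L)) * Real.exp (K + t - i * L)) /
          ballWeight w x (Real.exp (K + t - i * L))) := fun x =>
    mul_nonneg (hu x) (Finset.prod_nonneg fun i _ =>
      div_nonneg (ballWeight_nonneg hw _ _) (ballWeight_nonneg hw _ _))
  calc ∑ x, q x = ∑ x ∈ P, q x := by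
        refine (Finset.sum_subset (Finset.subset_univ P) fun x _ hx => ?_).symm
        have : w x = 0 := by
          refine le_antisymm (not_lt.1 fun h => hx ?_) (hw x)
          simpa [hP] using h
        simp [hq, this, Real.zero_rpow hε₀.ne']
    -- Prepares `1 + y ≤ exp y` at `y = G x t + m x`, whose `q`-weighted sum is nonnegative at this
    -- `t`.
    _ ≤ ∑ x ∈ P, q x * (G x t + m x + 1) := by
        simp only [mul_add, mul_one, Finset.sum_add_distrib] at hnn ⊢
        linarith
    _ ≤ ∑ x ∈ P, u x * ∏ i ∈ Finset.range n,
        (ballWeight w x (Real.exp (-(ε * L)) * Real.exp (K + t - i * L)) /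
          ballWeight w x (Real.exp (K + t - i * L))) := by
        refine Finset.sum_le_sum fun x hx => ?_
        have hx0 := hPw x hx
        have hW0 : 0 < W := hx0.trans_le (hWx x)
        rw [hq, mul_assoc]
        refine mul_le_mul_of_nonneg_left ?_ (hu x)
        have h1 : (w x / W) ^ ε = Real.exp (-m x) := by
          rw [Real.rpow_def_of_pos (div_pos hx0 hW0), Real.log_div hx0.ne' hW0.ne']
          congr 1
          simp only [hm]
          ring
        have h2 : ∏ i ∈ Finset.range n,
            (ballWeight w x (Real.exp (-(ε * L)) * Real.exp (K + t - i * L)) /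
              ballWeight w x (Real.exp (K + t - i * L))) = Real.exp (G x t) := by
          rw [hG, Real.exp_sum]
          refine Finset.prod_congr rfl fun i _ => ?_
          have hpos := fun a => ballWeight_pos hw hx0 (Real.exp_pos a).le
          rw [Real.exp_sub (φ x _), Real.exp_log (hpos _), Real.exp_log (hpos _), ← Real.exp_add,
            neg_add_eq_sub]
        rw [h1, h2]
        calc Real.exp (-m x) * (G x t + m x + 1)
            ≤ Real.exp (-m x) * Real.exp (G x t + m x) :=
              mul_le_mul_of_nonneg_left (Real.add_one_le_exp _) (Real.exp_pos _).le
          _ = Real.exp (G x t) := by rw [← Real.exp_add]; congr 1; ring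
    _ ≤ _ := Finset.sum_le_sum_of_subset_of_nonneg (Finset.subset_univ P) fun x _ _ => hprod x

end Shift

/-! ### Choice of parameters and conclusion -/

open Filter in
theorem mainTheorem6 {X : Type u} [MetricSpace X] [Fintype X] (w₁ w₂ : X → ℝ)
    (hw₁ : ∀ x, 0 ≤ w₁ x) (hw₂ : ∀ x, 0 ≤ w₂ x) (ε : ℝ) (hε₀ : 0 < ε) (hε₁ : ε < 1) :
    ∃ S : Finset X,
      EmbedsIntoUltrametric (2 / (ε * (1 - ε) ^ ((1 - ε) / ε))) (S : Set X) ∧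
      (∑ x ∈ S, w₁ x) * (∑ x, w₂ x) ^ ε ≥ ∑ x, w₁ x * w₂ x ^ ε := by
  have hs₀ : 0 < 1 - ε := sub_pos.2 hε₁
  -- This makes `s = 1 - ε`, which minimises `2 * s * exp L / (1 - s)` subject to `s = exp (-(ε *
  -- L))`.
  obtain ⟨L, hL⟩ : ∃ L, L = -Real.log (1 - ε) / ε := ⟨_, rfl⟩
  have hεL : ε * L = -Real.log (1 - ε) := by rw [hL]; field_simp
  have hL₀ : 0 < L := by
    rw [hL]
    exact div_pos (neg_pos.2 (Real.log_neg hs₀ (by linarith))) hε₀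
  have hs : Real.exp (-(ε * L)) = 1 - ε := by rw [hεL, neg_neg, Real.exp_log hs₀]
  have hτ : 1 ≤ 2 * (1 - ε) * Real.exp L := by
    rw [← hs, mul_assoc, ← Real.exp_add]
    have := Real.one_le_exp (x := -(ε * L) + L) (by nlinarith)
    linarith
  have hD : 2 / (ε * (1 - ε) ^ ((1 - ε) / ε)) = 2 * (1 - ε) * Real.exp L / (1 - (1 - ε)) := by
    have hpow : (1 - ε) ^ ((1 - ε) / ε) = ((1 - ε) * Real.exp L)⁻¹ := by
      rw [Real.rpow_def_of_pos hs₀, ← hs, ← Real.exp_add, ← Real.exp_neg, Real.log_exp, hs]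
      congr 1
      field_simp
      ring
    rw [hpow, sub_sub_cancel]
    have := (Real.exp_pos L).ne'
    field_simp
  obtain ⟨K, hK⟩ : ∃ K, ∀ x y : X, dist x y ≤ Real.exp K := by
    have : ∀ᶠ K in atTop, ∀ x y : X, dist x y ≤ Real.exp K :=
      eventually_all.2 fun x => eventually_all.2 fun y =>
        Real.tendsto_exp_atTop.eventually_ge_atTop _
    exact this.exists
  -- The last scale has exponent `K + t - (n - 1) * L < K + 2 * L - n * L`; the factor 2 passes from
  -- radius to diameter.
  obtain ⟨n, hn, hn₀⟩ : ∃ n : ℕ, (∀ x y : X, x ≠ y →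
      2 * Real.exp (K + 2 * L - n * L) < dist x y) ∧ 0 < n := by
    have hlim : Tendsto (fun n : ℕ => 2 * Real.exp (K + 2 * L - n * L)) atTop (nhds 0) := by
      rw [← mul_zero (2 : ℝ)]
      refine (Real.tendsto_exp_atBot.comp ?_).const_mul 2
      refine tendsto_atBot_add_const_left _ _ (tendsto_neg_atTop_atBot.comp ?_)
      exact tendsto_natCast_atTop_atTop.atTop_mul_const hL₀
    have : ∀ᶠ n : ℕ in atTop, ∀ x y : X, x ≠ y →
        2 * Real.exp (K + 2 * L - n * L) < dist x y :=
      eventually_all.2 fun x => eventually_all.2 fun y => eventually_all.2 fun hxy =>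
        hlim.eventually_lt_const (dist_pos.2 hxy)
    exact (this.and (eventually_gt_atTop 0)).exists
  obtain ⟨t, ⟨ht₀, ht₁⟩, ht⟩ := exists_shift hw₂ hw₁ hε₀ hε₁ hL₀ n hK (by
    intro x y hxy
    have h1 := hn x y hxy
    have h2 := Real.exp_le_exp.2 (show K + L - n * L ≤ K + 2 * L - n * L by linarith)
    have h3 := Real.exp_pos (K + L - n * L)
    linarith)
  rw [hs] at ht
  obtain ⟨S, c, hc, hsep, hS⟩ := exists_fragmentation_scales hw₂ (s := 1 - ε) (by linarith)
    (r := fun i => Real.exp (K + t - i * L)) (fun i => Real.exp_pos _) n hw₁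
  refine ⟨S, ?_, ?_⟩
  · rw [hD]
    refine EmbedsIntoUltrametric.of_clusters (S : Set X) hs₀ (by linarith) hτ
      (r := fun i => Real.exp (K + t - i * L)) (fun i => Real.exp_pos _) ?_ c hc hsep ?_ hn₀ ?_
    · intro i
      rw [← Real.exp_add]
      push_cast
      congr 1
      ring
    · intro x y
      refine (hK x y).trans (Real.exp_le_exp.2 ?_)
      push_cast
      linarith
    · intro x y hxy
      refine lt_of_le_of_lt ?_ (hn x y hxy)
      have h1 := Real.exp_pos (K + t - (n - 1 : ℕ) * L)
      have h2 : Real.exp (K + t - (n - 1 : ℕ) * L) ≤ Real.exp (K + 2 * L - n * L) := by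
        rw [Real.exp_le_exp, Nat.cast_sub hn₀]
        push_cast
        linarith
      nlinarith
  · have hle := ht.trans hS
    rcases (Finset.sum_nonneg fun x (_ : x ∈ Finset.univ) => hw₂ x).eq_or_lt with hW | hW
    · have h0 : ∀ x, w₂ x = 0 := fun x =>
        (Finset.sum_eq_zero_iff_of_nonneg fun x _ => hw₂ x).1 hW.symm x (Finset.mem_univ x)
      simp [h0, Real.zero_rpow hε₀.ne']
    · have hWε := Real.rpow_pos_of_pos hW ε
      rw [ge_iff_le, ← div_le_iff₀ hWε]
      refine le_trans (le_of_eq ?_) hle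
      rw [Finset.sum_div]
      refine Finset.sum_congr rfl fun x _ => ?_
      rw [Real.div_rpow (hw₂ x) hW.le, mul_div_assoc]
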